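/- All quantum systems are finite-dimensional. For a system $A$, a state is a positive semi-definite operator of unit trace on $\mathcal H_A$, and a channel is a completely positive trace-preserving linear map. Fix an integer $k\ge 1$. A state $\sigma_{AB}$ is $k$-extendible (written $\sigma_{AB}\in\mathrm{EXT}_k(A;B)$) if there is a state $\tau_{AB_1\cdots B_k}$, with each $B_i\simeq B$, that is invariant under all permutations of $B_1,\dots,B_k$ and satisfies $\operatorname{Tr}_{B_2\cdots B_k}[\tau_{AB_1\cdots B_k}]=\sigma_{AB}$. A bipartite channel $\mathcal K_{AB\to A'B'}$ is $k$-extendible if there is a channel $\mathcal M_{AB_1\cdots B_k\to A'B_1'\cdots B_k'}$ such that, for all states $\theta_{AB_1\cdots B_k}$, (i) $\mathcal M(\mathcal W^\pi_{B_1\cdots B_k}(\theta))=\mathcal W^\pi_{B_1'\cdots B_k'}(\mathcal M(\theta))$ for every $\pi\in S_k$, where $\mathcal W^\pi$ denotes the unitary channel that permutes the $k$ systems according to $\pi$, and (ii) $\operatorname{Tr}_{B_2'\cdots B_k'}[\mathcal M(\theta)]=\mathcal K(\operatorname{Tr}_{B_2\cdots B_k}[\theta])$. For $\varepsilon\in[0,1]$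 let $$D_h^\varepsilon(\rho\Vert\sigma)=-\log_2\inf_\Lambda\{\operatorname{Tr}[\Lambda\sigma]:0\le\Lambda\le I,\ \operatorname{Tr}[\Lambda\rho]\ge 1-\varepsilon\}\in[0,+\infty],\qquad E_k^\varepsilon(A;B)_\rho=\inf_{\sigma_{AB}\in\mathrm{EXT}_k(A;B)}D_h^\varepsilon(\rho_{AB}\Vert\sigma_{AB}),$$ where $-\log_2 0=+\infty$. Let $\mathcal N_{A\to B}$ be a $k$-simulable channel with resource state $\omega_{R\hat B}$, that is, a channel for which there is a $k$-extendible channel $\mathcal K_{RA\hat B\to B}$ (Alice's input is $RA$, Bob's input is $\hat B$, Alice's output is trivial, and Bob's output is $B$) such that $\mathcal N(\rho_A)=\mathcal K(\rho_A\otimes\omega_{R\hat B})$ for all states $\rho_A$. For integers $n,M\ge 1$, an $(n,M,\varepsilon)$ quantum communication protocol over $\mathcal N$ assisted by $k$-extendible channels consists of finite-dimensional systems $A_i',B_i'$ ($1\le i\le n$) of arbitrary dimensions, a $k$-extendible channel $\mathcal K^{(1)}_{\emptyset\to A_1'A_1:B_1'}$ with trivial inputs, $k$-extendible channels $\mathcal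 K^{(i)}_{A_{i-1}':B_{i-1}B_{i-1}'\to A_i'A_i:B_i'}$ for $2\le i\le n$, and a $k$-extendible channel $\mathcal K^{(n+1)}_{A_n':B_nB_n'\to M_A:M_B}$ with $|M_A|=|M_B|=M$, where each $A_i\simeq A$ and $B_i\simeq B$, and where the colons separate Alice's systems from Bob's. It generates $\rho^{(1)}=\mathcal K^{(1)}(1)$, $\sigma^{(i)}=\mathcal N_{A_i\to B_i}(\rho^{(i)})$ for $1\le i\le n$, $\rho^{(i)}=\mathcal K^{(i)}(\sigma^{(i-1)})$ for $2\le i\le n$, and the final state $\zeta_{M_AM_B}=\mathcal K^{(n+1)}(\sigma^{(n)})$, which is required to satisfy $F(\zeta_{M_AM_B},\Phi_{M_AM_B})\ge 1-\varepsilon$. Here $F(\rho,\sigma)=\Vert\sqrt\rho\sqrt\sigma\Vert_1^2$ and $\Phi_{M_AM_B}=\frac1M\sum_{m,m'}|m\rangle\langle m'|\otimes|m\rangle\langle m'|$. Then every $(n,M,\varepsilon)$ quantum communication protocol over $\mathcal N$ assisted by $k$-extendible channels, with $n,M\ge1$ and $\varepsilon\in[0,1]$, satisfies $$-\log_2\!\left[\frac1M+\frac1k-\frac1{Mk}\right]\le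 E_k^\varepsilon(R^n;\hat B^n)_{\omega^{\otimes n}}.$$ -/

import Mathlib

/-!
Finite-dimensional quantum systems are represented by finite index types (an orthonormal basis of
the Hilbert space), operators on a system `A` by `Matrix A A ℂ`, and the composite of systems
`A` and `B` by `A × B`.
-/

namespace KExt

open scoped ComplexOrder MatrixOrder

noncomputable section

/-- Operators on the system `A`. -/
abbrev Op (A : Type*) : Type _ := Matrix A A ℂ

/-- Density operators: positive semi-definite with unit trace. -/
def IsState {A : Type*} [Fintype A] (ρ : Op A) : Prop :=
  ρ.PosSemidef ∧ ρ.trace = 1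

/-- The superoperator `id_E ⊗ Φ`, acting on an operator of the composite system `E × A`. -/
def ampliation {A B : Type*} (E : Type*) (Φ : Op A →ₗ[ℂ] Op B) (X : Op (E × A)) : Op (E × B) :=
  Matrix.of fun p q => Φ (Matrix.of fun a a' => X (p.1, a) (q.1, a')) p.2 q.2

/-- Complete positivity: `id_m ⊗ Φ` preserves positive semi-definiteness for every dimension `m`
of the reference system. -/
def IsCP {A B : Type*} (Φ : Op A →ₗ[ℂ] Op B) : Prop :=
  ∀ (m : ℕ) (X : Op (Fin m × A)), X.PosSemidef → (ampliation (Fin m) Φ X).PosSemidef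

/-- Quantum channels: completely positive trace-preserving maps. -/
def IsChannel {A B : Type*} [Fintype A] [Fintype B] (Φ : Op A →ₗ[ℂ] Op B) : Prop :=
  IsCP Φ ∧ ∀ X : Op A, (Φ X).trace = X.trace

/-- The permutation channel `X ↦ W^π X (W^π)†`, where `W^π` is the unitary that sends the basis
vector `|a⟩|b₁⟩⋯|b_k⟩` to the basis vector `|a⟩|c₁⟩⋯|c_k⟩` with `c = b ∘ π⁻¹`. -/
def permChannel {A B : Type*} {k : ℕ} (π : Equiv.Perm (Fin k)) (X : Op (A × (Fin k → B))) :
    Op (A × (Fin k → B)) :=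
  X.submatrix (fun p => (p.1, p.2 ∘ π)) (fun p => (p.1, p.2 ∘ π))

/-- The partial trace over `B₂ ⋯ B_k` (all `B` systems but the first, which has index `0`). -/
def marginal {A B : Type*} [Fintype B] {k : ℕ} [NeZero k] (X : Op (A × (Fin k → B))) :
    Op (A × B) :=
  Matrix.of fun p q => ∑ c : {j : Fin k // j ≠ 0} → B,
    X (p.1, (Equiv.funSplitAt (0 : Fin k) B).symm (p.2, c))
      (q.1, (Equiv.funSplitAt (0 : Fin k) B).symm (q.2, c))

/-- `k`-extendible bipartite states, with respect to the second system. -/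
def IsKExtendibleState {A B : Type*} [Fintype A] [Fintype B] (k : ℕ) [NeZero k]
    (σ : Op (A × B)) : Prop :=
  IsState σ ∧ ∃ τ : Op (A × (Fin k → B)), IsState τ ∧
    (∀ π : Equiv.Perm (Fin k), permChannel π τ = τ) ∧ marginal τ = σ

/-- `k`-extendible bipartite channels `A B → A' B'`, with respect to the second systems. -/
def IsKExtendibleChannel {A B A' B' : Type*} [Fintype A] [Fintype B] [Fintype A'] [Fintype B']
    (k : ℕ) [NeZero k] (N : Op (A × B) →ₗ[ℂ] Op (A' × B')) : Prop :=
  IsChannel N ∧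
    ∃ M : Op (A × (Fin k → B)) →ₗ[ℂ] Op (A' × (Fin k → B')), IsChannel M ∧
      (∀ (π : Equiv.Perm (Fin k)) (θ : Op (A × (Fin k → B))), IsState θ →
        M (permChannel π θ) = permChannel π (M θ)) ∧
      (∀ θ : Op (A × (Fin k → B)), IsState θ → N (marginal θ) = marginal (M θ))

/-- The trace norm `‖X‖₁ = Tr √(X† X)`. -/
def traceNorm {A : Type*} [Fintype A] [DecidableEq A] (X : Op A) : ℝ :=
  (Matrix.trace (CFC.sqrt (X.conjTranspose * X))).re

/-- The fidelity `F(ρ, σ) = ‖√ρ √σ‖₁²`. -/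
def fidelity {A : Type*} [Fintype A] [DecidableEq A] (ρ σ : Op A) : ℝ :=
  traceNorm (CFC.sqrt ρ * CFC.sqrt σ) ^ 2

/-- The maximally entangled state `Φ = (1/M) ∑_{m,m'} |m⟩⟨m'| ⊗ |m⟩⟨m'|` of Schmidt rank `M`. -/
def maxEntangled (M : ℕ) : Op (Fin M × Fin M) :=
  Matrix.of fun p q => if p.1 = p.2 ∧ q.1 = q.2 then (1 / M : ℂ) else 0

/-- The infimum of `Tr[Λ σ]` over the tests `0 ≤ Λ ≤ I` with `Tr[Λ ρ] ≥ 1 - ε`. -/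
def hypTestInf {A : Type*} [Fintype A] [DecidableEq A] (ε : ℝ) (ρ σ : Op A) : ℝ :=
  sInf {x : ℝ | ∃ Λ : Op A, Λ.PosSemidef ∧ (1 - Λ).PosSemidef ∧
    1 - ε ≤ (Matrix.trace (Λ * ρ)).re ∧ x = (Matrix.trace (Λ * σ)).re}

/-- `-log₂ x` for `x ≥ 0`, with `-log₂ 0 = +∞`. -/
def negLog2 (x : ℝ) : EReal :=
  if x ≤ 0 then ⊤ else ((-Real.logb 2 x : ℝ) : EReal)

/-- The `ε`-hypothesis-testing divergence. -/
def hypTestDiv {A : Type*} [Fintype A] [DecidableEq A] (ε : ℝ) (ρ σ : Op A) : EReal :=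
  negLog2 (hypTestInf ε ρ σ)

/-- The `k`-unextendible `ε`-hypothesis-testing divergence `E_k^ε(A;B)_ρ`: the infimum of the
`ε`-hypothesis-testing divergence of `ρ` from the `k`-extendible states. -/
def unextHypTestDiv {A B : Type*} [Fintype A] [DecidableEq A] [Fintype B] [DecidableEq B]
    (k : ℕ) [NeZero k] (ε : ℝ) (ρ : Op (A × B)) : EReal :=
  ⨅ (σ : Op (A × B)) (_ : IsKExtendibleState k σ), hypTestDiv ε ρ σ

/-- `ω^{⊗ n}` as a bipartite operator with respect to the cut `Rⁿ : B̂ⁿ`. -/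
def tensorPow {R Bh : Type*} (ω : Op (R × Bh)) (n : ℕ) :
    Op ((Fin n → R) × (Fin n → Bh)) :=
  Matrix.of fun p q => ∏ i, ω (p.1 i, p.2 i) (q.1 i, q.2 i)

/-- `ρ_A ⊗ ω_{R B̂}`, as a bipartite operator with respect to the cut `R A : B̂`. -/
def attachResource {A R Bh : Type*} (ρ : Op A) (ω : Op (R × Bh)) : Op ((R × A) × Bh) :=
  Matrix.of fun p q => ρ p.1.2 q.1.2 * ω (p.1.1, p.2) (q.1.1, q.2)

/-- `N` is a `k`-simulable channel with resource state `ω_{R B̂}`: there is a `k`-extendible channel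
with Alice's input `R A`, Bob's input `B̂`, trivial output for Alice and output `B` for Bob, such
that `N ρ` is the output of this channel on `ρ_A ⊗ ω_{R B̂}` for all states `ρ`. -/
def IsKSimulableWith {A B R Bh : Type*} [Fintype A] [Fintype B] [Fintype R] [Fintype Bh]
    (k : ℕ) [NeZero k] (N : Op A →ₗ[ℂ] Op B) (ω : Op (R × Bh)) : Prop :=
  IsChannel N ∧ IsState ω ∧
    ∃ K : Op ((R × A) × Bh) →ₗ[ℂ] Op (Unit × B), IsKExtendibleChannel k K ∧
      ∀ ρ : Op A, IsState ρ →
        N ρ = (K (attachResource ρ ω)).submatrix (fun b => ((), b)) (fun b => ((), b))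

/-- One use of `N`: Alice feeds the system `A` of the shared operator on `A' A : B'` into `N`, and
Bob receives the output; the result is an operator on `A' : B B'`. -/
def useChannel {A B A' B' : Type*} (N : Op A →ₗ[ℂ] Op B) (X : Op ((A' × A) × B')) :
    Op (A' × (B × B')) :=
  Matrix.of fun p q =>
    N (Matrix.of fun a a' => X ((p.1, a), p.2.2) ((q.1, a'), q.2.2)) p.2.1 q.2.1

/-- A quantum communication protocol that uses the channel `N` from `A` to `B` `n ≥ 1` times,
interleaved by `k`-extendible channels, and finally yields systems of dimension `M` for Alice and
Bob. Rounds are numbered from `0` to `n - 1`; in round `i`, Alice's and Bob's memories are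
systems of arbitrary finite dimensions `dA i` and `dB i`. The data of rounds `i ≥ n` are
irrelevant. -/
structure Protocol {A B : Type*} [Fintype A] [Fintype B] (k : ℕ) [NeZero k]
    (N : Op A →ₗ[ℂ] Op B) (n M : ℕ) where
  dA : ℕ → ℕ
  dB : ℕ → ℕ
  /-- The first `k`-extendible channel, with trivial inputs. -/
  init : Op (Unit × Unit) →ₗ[ℂ] Op ((Fin (dA 0) × A) × Fin (dB 0))
  /-- The `k`-extendible channel between the uses of `N` in rounds `i` and `i + 1`. -/
  inter : (i : ℕ) → Op (Fin (dA i) × (B × Fin (dB i))) →ₗ[ℂ]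
    Op ((Fin (dA (i + 1)) × A) × Fin (dB (i + 1)))
  /-- The `k`-extendible channel after the last use of `N`. -/
  final : Op (Fin (dA (n - 1)) × (B × Fin (dB (n - 1)))) →ₗ[ℂ] Op (Fin M × Fin M)
  init_extendible : IsKExtendibleChannel k init
  inter_extendible : ∀ i, i + 1 < n → IsKExtendibleChannel k (inter i)
  final_extendible : IsKExtendibleChannel k final

namespace Protocol

variable {A B : Type*} [Fintype A] [Fintype B] {k : ℕ} [NeZero k] {N : Op A →ₗ[ℂ] Op B} {n M : ℕ}

/-- The state shared just before the use of `N` in round `i`. -/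
def before (P : Protocol k N n M) : (i : ℕ) → Op ((Fin (P.dA i) × A) × Fin (P.dB i))
  | 0 => P.init 1
  | i + 1 => P.inter i (useChannel N (before P i))

/-- The state shared just after the use of `N` in round `i`. -/
def after (P : Protocol k N n M) (i : ℕ) : Op (Fin (P.dA i) × (B × Fin (P.dB i))) :=
  useChannel N (P.before i)

/-- The final state of the protocol. -/
def output (P : Protocol k N n M) : Op (Fin M × Fin M) :=
  P.final (P.after (n - 1))

/-- The performance criterion of an `(n, M, ε)` protocol. -/
def Achieves (P : Protocol k N n M) (ε : ℝ) : Prop :=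
  1 - ε ≤ fidelity P.output (maxEntangled M)

end Protocol

end

end KExt

open KExt

/-! Each use of the channel is replaced by its simulation: a `k`-extendible channel acting on the
input and a fresh copy of `ω`. Since `k`-extendible channels are closed under composition and under
adjoining idle systems on both sides, the whole protocol becomes a single `k`-extendible channel `L`
that sends `ω^{⊗n}` to the final state (`Protocol.exists_isKExtendibleChannel_output`).

The maximally entangled state `Φ` is a projection, used as a test after `L`. On `ω^{⊗n}` it succeeds
with probability equal to the fidelity, at least `1 - ε` (`fidelity_maxEntangled`). On a
`k`-extendible `σ`, `L σ` is again `k`-extendible, so it succeeds with probability at most `1/M +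
1/k - 1/(Mk)` (`IsKExtendibleState.trace_maxEntangled_mul_re_le`). Pulling the test back along `L`
(`IsChannel.exists_test`) bounds the hypothesis-testing infimum for every such `σ`.

The overlap bound comes from the operator inequality `∑ⱼ M Φ_{ABⱼ} ≤ M + k - 1`
(`sum_star_mul_contract_re_le`): in a symmetric extension all `k` terms have the same expectation.
-/

namespace KExt

open scoped ComplexOrder MatrixOrder

noncomputable section

/-! ### From states to all operators by linearity -/

section Induction

open scoped Matrix.Norms.L2Operator in
/-- The positive semi-definite operators span all operators. -/
theorem span_posSemidef_eq_top {A : Type*} [Fintype A] :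
    Submodule.span ℂ {X : Op A | X.PosSemidef} = ⊤ := by
  classical
  have h : {X : Op A | X.PosSemidef} = {X : Op A | 0 ≤ X} := by
    ext X; exact Matrix.nonneg_iff_posSemidef.symm
  rw [h]
  exact CStarAlgebra.span_nonneg

/-- A linear property of operators that holds for all states holds for all operators. -/
theorem op_induction {A : Type*} [Fintype A] {p : Op A → Prop}
    (state : ∀ ρ, IsState ρ → p ρ) (zero : p 0) (add : ∀ X Y, p X → p Y → p (X + Y))
    (smul : ∀ (c : ℂ) X, p X → p (c • X)) (X : Op A) : p X := by
  have hX : X ∈ Submodule.span ℂ {X : Op A | X.PosSemidef} := by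
    rw [span_posSemidef_eq_top]; trivial
  induction hX using Submodule.span_induction with
  | zero => exact zero
  | add X Y _ _ hX hY => exact add X Y hX hY
  | smul c X _ hX => exact smul c X hX
  | mem P hP =>
    have hP : P.PosSemidef := hP
    by_cases h0 : P.trace = 0
    · rw [hP.trace_eq_zero_iff.1 h0]; exact zero
    · have : P = P.trace • (P.trace⁻¹ • P) := by rw [smul_smul, mul_inv_cancel₀ h0, one_smul]
      rw [this]
      refine smul _ _ (state _ ⟨hP.smul ?_, ?_⟩)
      · exact inv_nonneg.2 hP.trace_nonneg
      · rw [Matrix.trace_smul, smul_eq_mul, inv_mul_cancel₀ h0]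

end Induction

/-! ### Channels tensored with idle systems -/

section Ampliation

/-- `id_E ⊗ Φ` for a completely positive `Φ` and any finite reference system `E`. -/
theorem IsCP.posSemidef_ampliation {A B E : Type*} [Fintype E] {Φ : Op A →ₗ[ℂ] Op B}
    (h : IsCP Φ) {X : Op (E × A)} (hX : X.PosSemidef) : (ampliation E Φ X).PosSemidef := by
  let e := Fintype.equivFin E
  have h1 := (h _ _ (hX.submatrix (Prod.map e.symm id))).submatrix (Prod.map e (id : B → B))
  convert h1 using 1
  ext p q
  simp [ampliation, Matrix.submatrix_apply]

theorem IsCP.posSemidef_apply {A B : Type*} {Φ : Op A →ₗ[ℂ] Op B}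
    (h : IsCP Φ) {X : Op A} (hX : X.PosSemidef) : (Φ X).PosSemidef :=
  (h 1 _ (hX.submatrix Prod.snd)).submatrix (fun b => (0, b))

theorem IsChannel.isState_apply {A B : Type*} [Fintype A] [Fintype B] {Φ : Op A →ₗ[ℂ] Op B}
    (h : IsChannel Φ) {ρ : Op A} (hρ : IsState ρ) : IsState (Φ ρ) :=
  ⟨h.1.posSemidef_apply hρ.1, (h.2 ρ).trans hρ.2⟩

theorem IsChannel.comp {A B C : Type*} [Fintype A] [Fintype B] [Fintype C]
    {Ψ : Op B →ₗ[ℂ] Op C} {Φ : Op A →ₗ[ℂ] Op B} (hΨ : IsChannel Ψ) (hΦ : IsChannel Φ) :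
    IsChannel (Ψ ∘ₗ Φ) :=
  ⟨fun m X hX => hΨ.1 m _ (hΦ.1 m X hX), fun X => (hΨ.2 _).trans (hΦ.2 X)⟩

/-- `id_G ⊗ Φ`, with the composite systems `G × A` and `G × B` relabelled. -/
def blockMap {A B C D G : Type*} (e : C ≃ G × A) (f : D ≃ G × B) (Φ : Op A →ₗ[ℂ] Op B) :
    Op C →ₗ[ℂ] Op D where
  toFun X := (ampliation G Φ (X.submatrix e.symm e.symm)).submatrix f f
  map_add' X Y := by
    ext p q
    exact congrFun₂ (Φ.map_add (Matrix.of fun a a' => X (e.symm ((f p).1, a)) (e.symm ((f q).1, a')))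
      (Matrix.of fun a a' => Y (e.symm ((f p).1, a)) (e.symm ((f q).1, a')))) (f p).2 (f q).2
  map_smul' c X := by
    ext p q
    exact congrFun₂ (Φ.map_smul c
      (Matrix.of fun a a' => X (e.symm ((f p).1, a)) (e.symm ((f q).1, a')))) (f p).2 (f q).2

theorem IsChannel.blockMap {A B C D G : Type*} [Fintype A] [Fintype B] [Fintype C] [Fintype D]
    [Fintype G] (e : C ≃ G × A) (f : D ≃ G × B) {Φ : Op A →ₗ[ℂ] Op B} (h : IsChannel Φ) :
    IsChannel (blockMap e f Φ) := by
  refine ⟨fun m X hX => ?_, fun X => ?_⟩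
  · exact (h.1.posSemidef_ampliation (E := Fin m × G)
      (hX.submatrix (fun p : (Fin m × G) × A => (p.1.1, e.symm (p.1.2, p.2))))).submatrix
      (fun p : Fin m × D => ((p.1, (f p.2).1), (f p.2).2))
  · have h1 : (KExt.blockMap e f Φ X).trace = ∑ g, (Φ (Matrix.of fun a a' =>
        X (e.symm (g, a)) (e.symm (g, a')))).trace := by
      rw [Matrix.trace, ← f.symm.sum_comp, Fintype.sum_prod_type]
      refine Finset.sum_congr rfl fun g _ => Finset.sum_congr rfl fun b _ => ?_
      simp [KExt.blockMap, ampliation]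
    rw [h1, Matrix.trace, ← e.symm.sum_comp, Fintype.sum_prod_type]
    exact Finset.sum_congr rfl fun g _ => h.2 _

/-- `id_E ⊗ N ⊗ id_F` for a bipartite superoperator `N`, with `E` on Alice's side and `F` on Bob's
side, and with the four local systems relabelled. -/
def localAmpliation {A B A' B' C D C' D' E F : Type*} (a : C ≃ E × A) (b : D ≃ F × B)
    (a' : C' ≃ E × A') (b' : D' ≃ F × B') (N : Op (A × B) →ₗ[ℂ] Op (A' × B')) :
    Op (C × D) →ₗ[ℂ] Op (C' × D') :=
  blockMap ((a.prodCongr b).trans (Equiv.prodProdProdComm E A F B))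
    ((a'.prodCongr b').trans (Equiv.prodProdProdComm E A' F B')) N

theorem localAmpliation_apply {A B A' B' C D C' D' E F : Type*} (a : C ≃ E × A) (b : D ≃ F × B)
    (a' : C' ≃ E × A') (b' : D' ≃ F × B') (N : Op (A × B) →ₗ[ℂ] Op (A' × B')) (X : Op (C × D))
    (p q : C' × D') :
    localAmpliation a b a' b' N X p q =
      N (Matrix.of fun x y => X (a.symm ((a' p.1).1, x.1), b.symm ((b' p.2).1, x.2))
        (a.symm ((a' q.1).1, y.1), b.symm ((b' q.2).1, y.2)))
        ((a' p.1).2, (b' p.2).2) ((a' q.1).2, (b' q.2).2) := rfl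

/-- A copy of `D ≃ F × B` for each element of `ι`. -/
def arrowProdEquiv {D F B : Type*} (ι : Type*) (b : D ≃ F × B) : (ι → D) ≃ (ι → F) × (ι → B) :=
  (Equiv.arrowCongr (Equiv.refl ι) b).trans (Equiv.arrowProdEquivProdArrow ι _ _)

end Ampliation

/-! ### Closure properties of `k`-extendible channels -/

section Extendible

variable {A B A' B' : Type*} {k : ℕ} [NeZero k]

theorem arrowProdEquiv_symm_funSplitAt {D F : Type*} (b : D ≃ F × B) (f : F) (x : B)
    (cf : {j : Fin k // j ≠ 0} → F) (cx : {j : Fin k // j ≠ 0} → B) :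
    (arrowProdEquiv (Fin k) b).symm ((Equiv.funSplitAt (0 : Fin k) F).symm (f, cf),
      (Equiv.funSplitAt (0 : Fin k) B).symm (x, cx)) =
    (Equiv.funSplitAt (0 : Fin k) D).symm (b.symm (f, x),
      (arrowProdEquiv {j : Fin k // j ≠ 0} b).symm (cf, cx)) := by
  funext i
  by_cases h : i = 0
  · subst h
    simp [arrowProdEquiv, Equiv.arrowProdEquivProdArrow, Equiv.funSplitAt, Equiv.piSplitAt]
  · simp [arrowProdEquiv, Equiv.arrowProdEquivProdArrow, Equiv.funSplitAt, Equiv.piSplitAt, h]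

theorem arrowProdEquiv_funSplitAt {D F : Type*} (b : D ≃ F × B) (d : D)
    (cf : {j : Fin k // j ≠ 0} → F) (cx : {j : Fin k // j ≠ 0} → B) :
    arrowProdEquiv (Fin k) b ((Equiv.funSplitAt (0 : Fin k) D).symm (d,
      (arrowProdEquiv {j : Fin k // j ≠ 0} b).symm (cf, cx))) =
    ((Equiv.funSplitAt (0 : Fin k) F).symm ((b d).1, cf),
      (Equiv.funSplitAt (0 : Fin k) B).symm ((b d).2, cx)) := by
  rw [← Equiv.eq_symm_apply, arrowProdEquiv_symm_funSplitAt]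
  simp

theorem marginal_add [Fintype B] (X Y : Op (A × (Fin k → B))) :
    marginal (X + Y) = marginal X + marginal Y := by
  ext p q
  simp [marginal, Finset.sum_add_distrib]

theorem marginal_smul [Fintype B] (c : ℂ) (X : Op (A × (Fin k → B))) :
    marginal (c • X) = c • marginal X := by
  ext p q
  simp [marginal, Finset.mul_sum]

/-- A superoperator on `A B₁ ⋯ B_k` that commutes with the permutations of the `B` systems and
extends `N`, on all operators. -/
structure Extends [Fintype B] [Fintype B']
    (M : Op (A × (Fin k → B)) →ₗ[ℂ] Op (A' × (Fin k → B')))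
    (N : Op (A × B) →ₗ[ℂ] Op (A' × B')) : Prop where
  map_perm : ∀ (π : Equiv.Perm (Fin k)) X, M (permChannel π X) = permChannel π (M X)
  map_marginal : ∀ X, N (marginal X) = marginal (M X)

/-- Both conditions are linear in the operator, and states span. The form for all operators is
needed because ampliation applies the maps to off-diagonal blocks, which are not states. -/
theorem isKExtendibleChannel_iff [Fintype A] [Fintype B] [Fintype A'] [Fintype B']
    {N : Op (A × B) →ₗ[ℂ] Op (A' × B')} :
    IsKExtendibleChannel k N ↔ IsChannel N ∧
      ∃ M : Op (A × (Fin k → B)) →ₗ[ℂ] Op (A' × (Fin k → B')), IsChannel M ∧ Extends M N := by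
  refine and_congr_right fun _ => exists_congr fun M => and_congr_right fun _ =>
    ⟨fun ⟨h1, h2⟩ => ⟨fun π => ?_, ?_⟩,
      fun h => ⟨fun π θ _ => h.map_perm π θ, fun θ _ => h.map_marginal θ⟩⟩
  · refine op_induction (h1 π) ?_ (fun X Y hX hY => ?_) (fun c X hX => ?_)
    · rw [show permChannel π (0 : Op (A × (Fin k → B))) = 0 from rfl, map_zero]; rfl
    · rw [show permChannel π (X + Y) = permChannel π X + permChannel π Y from rfl, map_add, hX, hY,
        map_add]; rfl
    · rw [show permChannel π (c • X) = c • permChannel π X from rfl, map_smul, hX, map_smul]; rfl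
  · refine op_induction h2 ?_ (fun X Y hX hY => ?_) (fun c X hX => ?_)
    · have h0 : marginal (0 : Op (A × (Fin k → B))) = 0 := by ext; simp [marginal]
      have h0' : marginal (0 : Op (A' × (Fin k → B'))) = 0 := by ext; simp [marginal]
      rw [h0, map_zero, map_zero, h0']
    · rw [marginal_add, map_add, map_add, marginal_add, hX, hY]
    · rw [marginal_smul, map_smul, map_smul, marginal_smul, hX]

/-- Bob's idle system `F` has to be copied along with `B`, so the extension is `M` tensored with the
identity on `E` and on `k` copies of `F`. -/
theorem Extends.localAmpliation [Fintype B] [Fintype B'] {C D C' D' E F : Type*}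
    [Fintype D] [Fintype D'] [Fintype F]
    {M : Op (A × (Fin k → B)) →ₗ[ℂ] Op (A' × (Fin k → B'))} {N : Op (A × B) →ₗ[ℂ] Op (A' × B')}
    (h : Extends M N) (a : C ≃ E × A) (b : D ≃ F × B) (a' : C' ≃ E × A') (b' : D' ≃ F × B') :
    Extends (localAmpliation a (arrowProdEquiv (Fin k) b) a' (arrowProdEquiv (Fin k) b') M)
      (localAmpliation a b a' b' N) := by
  refine ⟨fun π X => ?_, fun X => ?_⟩
  · ext p q
    exact congrFun₂ (h.map_perm π (Matrix.of fun x y =>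
      X (a.symm ((a' p.1).1, x.1), (arrowProdEquiv (Fin k) b).symm
        ((arrowProdEquiv (Fin k) b' (p.2 ∘ π)).1, x.2))
      (a.symm ((a' q.1).1, y.1), (arrowProdEquiv (Fin k) b).symm
        ((arrowProdEquiv (Fin k) b' (q.2 ∘ π)).1, y.2))))
      ((a' p.1).2, (arrowProdEquiv (Fin k) b' p.2).2) ((a' q.1).2, (arrowProdEquiv (Fin k) b' q.2).2)
  -- `Y u v cf` is the block of `X` with the idle indices fixed, diagonal (`cf`) in the copies of
  -- `F` to be traced out. Summing its marginal over `cf` gives the input block of `N`, so linearity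
  -- of `N` reduces the claim to `M` and `N` block by block.
  · let Y (u v : C' × D') (cf : {j : Fin k // j ≠ 0} → F) : Op (A × (Fin k → B)) :=
      Matrix.of fun x y => X (a.symm ((a' u.1).1, x.1), (arrowProdEquiv (Fin k) b).symm
        ((Equiv.funSplitAt (0 : Fin k) F).symm ((b' u.2).1, cf), x.2))
      (a.symm ((a' v.1).1, y.1), (arrowProdEquiv (Fin k) b).symm
        ((Equiv.funSplitAt (0 : Fin k) F).symm ((b' v.2).1, cf), y.2))
    ext p q
    rw [localAmpliation_apply]
    have h1 : (Matrix.of fun x y : A × B =>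
        marginal X (a.symm ((a' p.1).1, x.1), b.symm ((b' p.2).1, x.2))
        (a.symm ((a' q.1).1, y.1), b.symm ((b' q.2).1, y.2))) = ∑ cf, marginal (Y p q cf) := by
      ext x y
      rw [Matrix.sum_apply]
      simp only [marginal, Matrix.of_apply, Y, arrowProdEquiv_symm_funSplitAt]
      rw [← (arrowProdEquiv {j : Fin k // j ≠ 0} b).symm.sum_comp, Fintype.sum_prod_type]
    rw [h1, map_sum, Matrix.sum_apply]
    simp only [h.map_marginal]
    simp only [marginal, Matrix.of_apply]
    rw [← (arrowProdEquiv {j : Fin k // j ≠ 0} b').symm.sum_comp, Fintype.sum_prod_type]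
    refine Finset.sum_congr rfl fun cf _ => Finset.sum_congr rfl fun cx _ => ?_
    rw [localAmpliation_apply]
    simp only [arrowProdEquiv_funSplitAt]
    rfl

variable [Fintype A] [Fintype B] [Fintype A'] [Fintype B']

theorem IsKExtendibleChannel.comp {A₂ B₂ : Type*} [Fintype A₂] [Fintype B₂]
    {N₂ : Op (A' × B') →ₗ[ℂ] Op (A₂ × B₂)} {N : Op (A × B) →ₗ[ℂ] Op (A' × B')}
    (h₂ : IsKExtendibleChannel k N₂) (h : IsKExtendibleChannel k N) :
    IsKExtendibleChannel k (N₂ ∘ₗ N) := by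
  rw [isKExtendibleChannel_iff] at *
  obtain ⟨hN₂, M₂, hM₂, e₂⟩ := h₂
  obtain ⟨hN, M, hM, e⟩ := h
  refine ⟨hN₂.comp hN, M₂ ∘ₗ M, hM₂.comp hM, fun π X => ?_, fun X => ?_⟩
  · simp [e.map_perm, e₂.map_perm]
  · simp [e.map_marginal, e₂.map_marginal]

theorem IsKExtendibleChannel.localAmpliation {C D C' D' E F : Type*}
    [Fintype C] [Fintype D] [Fintype C'] [Fintype D'] [Fintype E] [Fintype F]
    {N : Op (A × B) →ₗ[ℂ] Op (A' × B')} (h : IsKExtendibleChannel k N)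
    (a : C ≃ E × A) (b : D ≃ F × B) (a' : C' ≃ E × A') (b' : D' ≃ F × B') :
    IsKExtendibleChannel k (localAmpliation a b a' b' N) := by
  rw [isKExtendibleChannel_iff] at *
  obtain ⟨hN, M, hM, e⟩ := h
  exact ⟨hN.blockMap _ _, _, hM.blockMap _ _, e.localAmpliation a b a' b'⟩

theorem IsKExtendibleChannel.isKExtendibleState_apply {N : Op (A × B) →ₗ[ℂ] Op (A' × B')}
    (h : IsKExtendibleChannel k N) {σ : Op (A × B)} (hσ : IsKExtendibleState k σ) :
    IsKExtendibleState k (N σ) := by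
  obtain ⟨hN, M, hM, h1, h2⟩ := h
  obtain ⟨hs, τ, hτ, hp, rfl⟩ := hσ
  exact ⟨hN.isState_apply hs, M τ, hM.isState_apply hτ, fun π => by rw [← h1 π τ hτ, hp],
    (h2 τ hτ).symm⟩

end Extendible

/-! ### The protocol as one `k`-extendible channel on copies of the resource -/

section Simulation

variable {A B R Bh : Type*} [Fintype A]

theorem attachResource_simulation {N : Op A →ₗ[ℂ] Op B} {ω : Op (R × Bh)}
    {K : Op ((R × A) × Bh) →ₗ[ℂ] Op (Unit × B)}
    (h : ∀ ρ : Op A, IsState ρ →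
        N ρ = (K (attachResource ρ ω)).submatrix (fun b => ((), b)) (fun b => ((), b)))
    (X : Op A) :
    N X = (K (attachResource X ω)).submatrix (fun b => ((), b)) (fun b => ((), b)) := by
  refine op_induction h ?_ (fun X Y hX hY => ?_) (fun c X hX => ?_) X
  · have : attachResource (0 : Op A) ω = 0 := by ext; simp [attachResource]
    rw [this, map_zero, map_zero]; rfl
  · have : attachResource (X + Y) ω = attachResource X ω + attachResource Y ω := by
      ext; simp [attachResource, add_mul]
    rw [this, map_add, map_add, hX, hY]; rfl
  · have : attachResource (c • X) ω = c • attachResource X ω := by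
      ext; simp [attachResource, mul_assoc]
    rw [this, map_smul, map_smul, hX]; rfl

variable [Fintype B] [Fintype R] [Fintype Bh] {k : ℕ} [NeZero k]

/-- `E × (R × A)` as a relabelling of `R × (E × A)`. -/
def leftCommEquiv (R E A : Type*) : R × (E × A) ≃ E × (R × A) where
  toFun p := (p.2.1, (p.1, p.2.2))
  invFun p := (p.2.1, (p.1, p.2.2))

/-- A resource-assisted use of a simulable channel is a `k`-extendible channel. -/
theorem exists_isKExtendibleChannel_useChannel {S T E F : Type*} [Fintype S] [Fintype T]
    [Fintype E] [Fintype F] {N : Op A →ₗ[ℂ] Op B} {ω : Op (R × Bh)} (hN : IsKSimulableWith k N ω)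
    {L : Op (S × T) →ₗ[ℂ] Op ((E × A) × F)} (hL : IsKExtendibleChannel k L) {S' T' : Type*}
    [Fintype S'] [Fintype T'] (s : S' ≃ R × S) (t : T' ≃ Bh × T) :
    ∃ L' : Op (S' × T') →ₗ[ℂ] Op (E × (B × F)), IsKExtendibleChannel k L' ∧
      ∀ X : Op (S × T), L' (Matrix.of fun p q =>
        ω ((s p.1).1, (t p.2).1) ((s q.1).1, (t q.2).1) *
          X ((s p.1).2, (t p.2).2) ((s q.1).2, (t q.2).2)) = useChannel N (L X) := by
  obtain ⟨-, -, K, hK, hsim⟩ := hN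
  refine ⟨localAmpliation (leftCommEquiv R E A) (Equiv.prodComm Bh F)
    (Equiv.prodPUnit E).symm (Equiv.prodComm B F) K ∘ₗ
      localAmpliation s t (Equiv.refl _) (Equiv.refl _) L,
    (hK.localAmpliation _ _ _ _).comp (hL.localAmpliation _ _ _ _), fun X => ?_⟩
  ext p q
  rw [LinearMap.comp_apply, localAmpliation_apply, useChannel, Matrix.of_apply,
    attachResource_simulation hsim, Matrix.submatrix_apply]
  refine congrFun₂ (congrArg K ?_) _ _
  ext x y
  rw [Matrix.of_apply, localAmpliation_apply]
  -- With the indices of `R` and `Bh` fixed, the input block of `L` is a scalar entry of `ω` times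
  -- `X`; the scalar comes out of `L` and rebuilds `attachResource`.
  refine (congrFun₂ ((congrArg L (?_ : _ = ω (x.1.1, x.2) (y.1.1, y.2) • X)).trans
    (L.map_smul _ _)) _ _).trans ?_
  · ext x' y'
    simp [leftCommEquiv]
  exact mul_comm _ _

/-- Rounds are counted from `0`, so after round `i` exactly `i + 1` copies of `ω` have been
consumed. -/
theorem Protocol.exists_isKExtendibleChannel_after {N : Op A →ₗ[ℂ] Op B} {ω : Op (R × Bh)}
    (hN : IsKSimulableWith k N ω) {n M : ℕ} (P : Protocol k N n M) :
    ∀ i, i < n → ∃ L : Op ((Fin (i + 1) → R) × (Fin (i + 1) → Bh)) →ₗ[ℂ]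
        Op (Fin (P.dA i) × (B × Fin (P.dB i))),
      IsKExtendibleChannel k L ∧ L (tensorPow ω (i + 1)) = P.after i := by
  have step : ∀ i, (∃ L : Op ((Fin i → R) × (Fin i → Bh)) →ₗ[ℂ]
        Op ((Fin (P.dA i) × A) × Fin (P.dB i)),
      IsKExtendibleChannel k L ∧ L (tensorPow ω i) = P.before i) →
      ∃ L : Op ((Fin (i + 1) → R) × (Fin (i + 1) → Bh)) →ₗ[ℂ]
        Op (Fin (P.dA i) × (B × Fin (P.dB i))),
      IsKExtendibleChannel k L ∧ L (tensorPow ω (i + 1)) = P.after i := by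
    rintro i ⟨L, hL, h⟩
    obtain ⟨L', hL', h'⟩ := exists_isKExtendibleChannel_useChannel hN hL
      (Fin.consEquiv fun _ : Fin (i + 1) => R).symm (Fin.consEquiv fun _ : Fin (i + 1) => Bh).symm
    refine ⟨L', hL', ?_⟩
    rw [Protocol.after, ← h, ← h' (tensorPow ω i)]
    congr 1
    ext p q
    simp only [tensorPow, Matrix.of_apply, Fin.prod_univ_succ]
    rfl
  intro i
  induction i with
  | zero =>
    intro _
    -- With no copies consumed, both input systems are one-dimensional and `tensorPow ω 0` is the
    -- empty product `1`, the trivial input of `P.init`.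
    refine step 0 ⟨localAmpliation
      ((Equiv.ofUnique _ Unit).trans (Equiv.prodPUnit Unit).symm)
      ((Equiv.ofUnique _ Unit).trans (Equiv.prodPUnit Unit).symm)
      (Equiv.punitProd _).symm (Equiv.punitProd _).symm P.init,
      P.init_extendible.localAmpliation _ _ _ _, ?_⟩
    ext p q
    rw [localAmpliation_apply, Protocol.before]
    refine congrFun₂ (congrArg P.init ?_) _ _
    ext x y
    obtain rfl : x = y := Subsingleton.elim _ _
    simp only [tensorPow, Matrix.of_apply, Finset.univ_eq_empty, Finset.prod_empty]
    exact (Matrix.one_apply_eq x).symm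
  | succ i ih =>
    intro hi
    obtain ⟨L, hL, h⟩ := ih (by omega)
    refine step (i + 1) ⟨P.inter i ∘ₗ L, (P.inter_extendible i hi).comp hL, ?_⟩
    rw [LinearMap.comp_apply, h]
    rfl

theorem Protocol.exists_isKExtendibleChannel_output {N : Op A →ₗ[ℂ] Op B} {ω : Op (R × Bh)}
    (hN : IsKSimulableWith k N ω) {n M : ℕ} (hn : 1 ≤ n) (P : Protocol k N n M) :
    ∃ L : Op ((Fin n → R) × (Fin n → Bh)) →ₗ[ℂ] Op (Fin M × Fin M),
      IsKExtendibleChannel k L ∧ L (tensorPow ω n) = P.output := by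
  obtain ⟨m, rfl⟩ : ∃ m, n = m + 1 := ⟨n - 1, by omega⟩
  obtain ⟨L, hL, h⟩ := P.exists_isKExtendibleChannel_after hN m (by omega)
  refine ⟨P.final ∘ₗ L, P.final_extendible.comp hL, ?_⟩
  rw [LinearMap.comp_apply, h]
  rfl

/-- The tensor power is an entrywise product of submatrices of `ω` (with repeated indices), so the
Schur product theorem applies factor by factor. -/
theorem posSemidef_tensorPow {ω : Op (R × Bh)} (hω : ω.PosSemidef) (n : ℕ) :
    (tensorPow ω n).PosSemidef := by
  have h : ∀ s : Finset (Fin n), (Matrix.of fun p q : (Fin n → R) × (Fin n → Bh) =>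
      ∏ i ∈ s, ω (p.1 i, p.2 i) (q.1 i, q.2 i)).PosSemidef := by
    intro s
    induction s using Finset.induction_on with
    | empty =>
      convert Matrix.posSemidef_vecMulVec_self_star
        (fun _ : (Fin n → R) × (Fin n → Bh) => (1 : ℂ)) using 1
      ext p q
      simp [Matrix.vecMulVec_apply]
    | insert i s hi ih =>
      have hmul : (Matrix.of fun p q : (Fin n → R) × (Fin n → Bh) =>
          ∏ j ∈ insert i s, ω (p.1 j, p.2 j) (q.1 j, q.2 j)) =
          (ω.submatrix (fun p : (Fin n → R) × (Fin n → Bh) => (p.1 i, p.2 i))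
            (fun p => (p.1 i, p.2 i))).hadamard
          (Matrix.of fun p q => ∏ j ∈ s, ω (p.1 j, p.2 j) (q.1 j, q.2 j)) := by
        ext p q
        simp [Finset.prod_insert hi]
      rw [hmul]
      exact (hω.submatrix _).hadamard ih
  exact h Finset.univ

end Simulation

/-! ### Operator norm of the sum of the projections `M Φ_{ABⱼ}`, up to scale -/

section Overlap

variable {ι S : Type*} [DecidableEq ι] [Fintype S]

/-- The vector obtained by contracting the first system with the `j`-th of the other systems,
tensored with the all-ones vector on the `j`-th system. -/
def contract (x : S × (ι → S) → ℂ) (j : ι) (b : ι → S) : ℂ :=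
  ∑ m, x (m, Function.update b j m)

theorem contract_update (x : S × (ι → S) → ℂ) (j : ι) (b : ι → S) (m : S) :
    contract x j (Function.update b j m) = contract x j b := by
  simp [contract]

variable [Fintype ι]

/-- Exchanging `b i` with `m` is an involution of the pairs `(b, m)`. -/
theorem sum_sum_update {R : Type*} [AddCommMonoid R] (i : ι) (F : (ι → S) → S → R) :
    ∑ b, ∑ m, F b m = ∑ b, ∑ m, F (Function.update b i m) (b i) := by
  rw [← Fintype.sum_prod_type', ← Fintype.sum_prod_type']
  have hinv : Function.Involutive
      (fun p : (ι → S) × S => (Function.update p.1 i p.2, p.1 i)) := fun p => by simp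
  exact (Equiv.sum_comp hinv.toPerm fun p : (ι → S) × S => F p.1 p.2).symm

/-- As `g` ignores the coordinate `j`, the constraint `b i = b j` selects one of its `card S`
values. -/
theorem card_mul_sum_ite_eq [DecidableEq S] {i j : ι} (hij : i ≠ j) (g : (ι → S) → ℝ)
    (hg : ∀ b m, g (Function.update b j m) = g b) :
    (Fintype.card S : ℝ) * ∑ b : ι → S, (if b i = b j then g b else 0) = ∑ b, g b := by
  have h := sum_sum_update j (fun (b : ι → S) m => if b i = m then g b else 0)
  simp only [Finset.sum_ite_eq, Finset.mem_univ, if_true, Function.update_of_ne hij, hg,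
    Finset.sum_const, Finset.card_univ, nsmul_eq_mul] at h
  rw [h, Finset.mul_sum]

theorem card_mul_sum_star_mul_contract (x : S × (ι → S) → ℂ) (j : ι) :
    (Fintype.card S : ℂ) * ∑ b, star (x (b j, b)) * contract x j b =
      ((∑ b, ‖contract x j b‖ ^ 2 : ℝ) : ℂ) := by
  have h := sum_sum_update j (fun (b : ι → S) (_ : S) => star (x (b j, b)) * contract x j b)
  simp only [contract_update, Function.update_self, Finset.sum_const, Finset.card_univ,
    nsmul_eq_mul, ← Finset.sum_mul, ← Finset.mul_sum] at h
  rw [h]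
  push_cast
  refine Finset.sum_congr rfl fun b _ => ?_
  rw [← star_sum]
  exact Complex.conj_mul' _

/-- Let `H = ∑ⱼ |S| Φ_{ABⱼ}` and `l = |S| + |ι| - 1`. The left side is `⟨x, Hx⟩`; the proof shows
`‖Hx‖² ≤ l ⟨x, Hx⟩` and expands `‖l x - Hx‖² ≥ 0`. -/
theorem sum_star_mul_contract_re_le [Nonempty S] [Nonempty ι] (x : S × (ι → S) → ℂ) :
    (∑ j, ∑ b, star (x (b j, b)) * contract x j b).re ≤
      ((Fintype.card S : ℝ) + Fintype.card ι - 1) * ∑ p, ‖x p‖ ^ 2 := by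
  classical
  set s : ℝ := (Fintype.card S : ℝ) with hs
  set n : ℝ := (Fintype.card ι : ℝ) with hn
  have hs1 : 1 ≤ s := by rw [hs]; exact_mod_cast Fintype.card_pos
  have hn1 : 1 ≤ n := by rw [hn]; exact_mod_cast Fintype.card_pos
  set T := ∑ j, ∑ b, star (x (b j, b)) * contract x j b with hT
  let W : ι → ℝ := fun j => ∑ b, ‖contract x j b‖ ^ 2
  have hTW : s * T.re = ∑ j, W j := by
    have : (s : ℂ) * T = ((∑ j, W j : ℝ) : ℂ) := by
      rw [hT, Finset.mul_sum]
      push_cast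
      exact Finset.sum_congr rfl fun j _ => by
        simpa [hs, W] using card_mul_sum_star_mul_contract x j
    have := congrArg Complex.re this
    simpa using this
  -- The vector `y` is `Hx`.
  let y : S × (ι → S) → ℂ := fun p => ∑ j, if p.2 j = p.1 then contract x j p.2 else 0
  have hxy : ∑ p, star (x p) * y p = T := by
    rw [Fintype.sum_prod_type_right, hT, Finset.sum_comm (s := (Finset.univ : Finset ι))]
    refine Finset.sum_congr rfl fun b _ => ?_
    simp only [y, Finset.mul_sum, mul_ite, mul_zero]
    rw [Finset.sum_comm]
    simp
  have hy : s * ∑ p, ‖y p‖ ^ 2 ≤ (s + n - 1) * ∑ j, W j := by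
    -- Cauchy–Schwarz over only those `j` with `p.2 j = p.1`; their number is written as the sum
    -- over `i`.
    have h1 : ∀ p, ‖y p‖ ^ 2 ≤
        ∑ i, ∑ j, if p.2 i = p.1 then (if p.2 j = p.1 then ‖contract x j p.2‖ ^ 2 else 0) else 0 := by
      intro p
      have e1 : ‖y p‖ ≤ ∑ j ∈ Finset.univ.filter (fun j => p.2 j = p.1), ‖contract x j p.2‖ := by
        simp only [y, ← Finset.sum_filter]
        exact norm_sum_le _ _
      have e2 := sq_sum_le_card_mul_sum_sq (s := Finset.univ.filter (fun j => p.2 j = p.1))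
        (f := fun j => ‖contract x j p.2‖)
      refine (pow_le_pow_left₀ (norm_nonneg _) e1 2).trans (e2.trans_eq ?_)
      rw [← nsmul_eq_mul, ← Finset.sum_const, Finset.sum_filter]
      refine Finset.sum_congr rfl fun i _ => ?_
      split_ifs
      · rw [Finset.sum_filter]
      · simp
    have h2 : ∑ p, ‖y p‖ ^ 2 ≤
        ∑ j, ∑ i, ∑ b : ι → S, if b i = b j then ‖contract x j b‖ ^ 2 else 0 := by
      refine (Finset.sum_le_sum fun p _ => h1 p).trans_eq ?_
      rw [Finset.sum_comm, Finset.sum_congr rfl fun i _ => Finset.sum_comm,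
        Finset.sum_comm (s := (Finset.univ : Finset ι))]
      refine Finset.sum_congr rfl fun j _ => Finset.sum_congr rfl fun i _ => ?_
      rw [Fintype.sum_prod_type_right]
      exact Finset.sum_congr rfl fun b _ => by simp [eq_comm]
    -- The term `i = j` contributes `s * W j`, and each of the other `n - 1` contributes `W j`;
    -- hence the constant `s + n - 1`.
    have h3 : ∀ j, s * ∑ i, ∑ b : ι → S, (if b i = b j then ‖contract x j b‖ ^ 2 else 0) =
        (s + n - 1) * W j := by
      intro j
      rw [← Finset.add_sum_erase _ _ (Finset.mem_univ j), mul_add,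
        Finset.mul_sum (Finset.univ.erase j)]
      have : ∀ i ∈ Finset.univ.erase j,
          s * ∑ b : ι → S, (if b i = b j then ‖contract x j b‖ ^ 2 else 0) = W j := fun i hi =>
        card_mul_sum_ite_eq (Finset.ne_of_mem_erase hi) _ fun b m => by rw [contract_update]
      rw [Finset.sum_congr rfl this, Finset.sum_const, Finset.card_erase_of_mem (Finset.mem_univ j),
        Finset.card_univ, nsmul_eq_mul, Nat.cast_sub Fintype.card_pos]
      simp only [if_true, W]
      push_cast
      ring
    calc s * ∑ p, ‖y p‖ ^ 2 ≤ _ := mul_le_mul_of_nonneg_left h2 (by linarith)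
      _ = _ := by
        rw [Finset.mul_sum Finset.univ W]
        exact (Finset.mul_sum _ _ _).trans (Finset.sum_congr rfl fun j _ => h3 j)
  set l := s + n - 1 with hl
  have hl0 : 0 < l := by rw [hl]; linarith
  have hexp : ∑ p, ‖(l : ℂ) * x p - y p‖ ^ 2 =
      l ^ 2 * ∑ p, ‖x p‖ ^ 2 - 2 * l * T.re + ∑ p, ‖y p‖ ^ 2 := by
    rw [← hxy, Complex.re_sum, Finset.mul_sum, Finset.mul_sum, ← Finset.sum_sub_distrib,
      ← Finset.sum_add_distrib]
    refine Finset.sum_congr rfl fun p _ => ?_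
    simp only [← Complex.normSq_eq_norm_sq, Complex.normSq_apply, Complex.star_def]
    simp
    ring
  have h0 : 0 ≤ ∑ p, ‖(l : ℂ) * x p - y p‖ ^ 2 := Finset.sum_nonneg fun p _ => by positivity
  rw [hexp] at h0
  have hy' : ∑ p, ‖y p‖ ^ 2 ≤ l * T.re := by
    rw [← hTW] at hy
    refine le_of_mul_le_mul_left (a := s) ?_ (by linarith)
    linarith
  refine le_of_mul_le_mul_left (a := l) ?_ hl0
  nlinarith

end Overlap

theorem exists_eq_conjTranspose_mul_self {A : Type*} [Fintype A] {X : Op A} (hX : X.PosSemidef) :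
    ∃ C : Op A, X = C.conjTranspose * C := by
  classical
  refine ⟨CFC.sqrt X, ?_⟩
  rw [(Matrix.nonneg_iff_posSemidef.1 (CFC.sqrt_nonneg X)).isHermitian.eq,
    CFC.sqrt_mul_sqrt_self X (Matrix.nonneg_iff_posSemidef.2 hX)]

/-! ### Maximally entangled fraction of `k`-extendible states -/

section ExtendibleState

variable {M k : ℕ} [NeZero k]

theorem trace_maxEntangled_mul (σ : Op (Fin M × Fin M)) :
    (maxEntangled M * σ).trace = (1 / M : ℂ) * ∑ m, ∑ m', σ (m, m) (m', m') := by
  rw [Matrix.trace_mul_comm]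
  simp only [Matrix.trace, Matrix.diag, Matrix.mul_apply, maxEntangled, Matrix.of_apply,
    Fintype.sum_prod_type, mul_ite, mul_zero, ite_and, Finset.mul_sum]
  simp [mul_comm]

/-- `M · Tr[Φ_{A B_j} τ]`, where `Φ` is the maximally entangled state. -/
def overlap {k : ℕ} (τ : Op (Fin M × (Fin k → Fin M))) (j : Fin k) : ℂ :=
  ∑ b : Fin k → Fin M, ∑ m, τ (b j, b) (m, Function.update b j m)

theorem overlap_zero (τ : Op (Fin M × (Fin k → Fin M))) :
    overlap τ 0 = ∑ m, ∑ m', marginal τ (m, m) (m', m') := by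
  rw [overlap, ← (Equiv.funSplitAt (0 : Fin k) (Fin M)).symm.sum_comp, Fintype.sum_prod_type]
  refine Finset.sum_congr rfl fun m _ => ?_
  rw [Finset.sum_comm]
  refine Finset.sum_congr rfl fun m' _ => ?_
  simp only [marginal, Matrix.of_apply]
  refine Finset.sum_congr rfl fun c _ => ?_
  congr 2
  funext i
  simp only [Equiv.funSplitAt, Equiv.piSplitAt_symm_apply]
  by_cases h : i = 0
  · subst h; simp
  · simp [h]

/-- Invariance under the transposition of `0` and `j`, after relabelling the summation index in the
same way. -/
theorem overlap_eq_zero_index {τ : Op (Fin M × (Fin k → Fin M))}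
    (h : ∀ π : Equiv.Perm (Fin k), permChannel π τ = τ) (j : Fin k) :
    overlap τ j = overlap τ 0 := by
  have hs := h (Equiv.swap 0 j)
  rw [overlap, ← (Equiv.arrowCongr (Equiv.swap 0 j) (Equiv.refl (Fin M))).sum_comp, overlap]
  refine Finset.sum_congr rfl fun b _ => Finset.sum_congr rfl fun m _ => ?_
  conv_rhs => rw [← hs]
  simp only [permChannel, Matrix.submatrix_apply]
  congr 2
  · simp
  · funext i
    by_cases hi : i = j
    · subst hi; simp
    · have : Equiv.swap 0 j i ≠ 0 := fun h0 =>
        hi ((Equiv.swap 0 j).injective (h0.trans (Equiv.swap_apply_right 0 j).symm))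
      simp [Function.update_of_ne hi, Function.update_of_ne this]

/-- Writing `τ = C†C` reduces the trace against `τ` to the vector inequality for each row of `C`. -/
theorem sum_overlap_re_le (hM : 1 ≤ M) {τ : Op (Fin M × (Fin k → Fin M))} (hτ : τ.PosSemidef) :
    (∑ j, overlap τ j).re ≤ ((M : ℝ) + k - 1) * τ.trace.re := by
  have : Nonempty (Fin M) := ⟨⟨0, hM⟩⟩
  obtain ⟨C, rfl⟩ := exists_eq_conjTranspose_mul_self hτ
  have h1 : ∑ j, overlap (C.conjTranspose * C) j =
      ∑ r, ∑ j : Fin k, ∑ b : Fin k → Fin M, star (C r (b j, b)) * contract (C r) j b := by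
    rw [Finset.sum_comm]
    refine Finset.sum_congr rfl fun j _ => ?_
    rw [overlap, Finset.sum_comm (s := (Finset.univ : Finset (Fin M × (Fin k → Fin M))))]
    refine Finset.sum_congr rfl fun b _ => ?_
    simp only [contract, Finset.mul_sum, Matrix.mul_apply, Matrix.conjTranspose_apply]
    rw [Finset.sum_comm]
  have h2 : (C.conjTranspose * C).trace.re = ∑ r, ∑ p, ‖C r p‖ ^ 2 := by
    simp only [Matrix.trace, Matrix.diag, Matrix.mul_apply, Matrix.conjTranspose_apply]
    rw [Finset.sum_comm, Complex.re_sum]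
    refine Finset.sum_congr rfl fun r _ => ?_
    rw [Complex.re_sum]
    refine Finset.sum_congr rfl fun p _ => ?_
    have := congrArg Complex.re (Complex.conj_mul' (C r p))
    rw [Complex.star_def, this]
    norm_cast
  rw [h1, h2, Complex.re_sum, Finset.mul_sum]
  refine Finset.sum_le_sum fun r _ => ?_
  simpa using sum_star_mul_contract_re_le (C r)

/-- The overlap of a `k`-extendible state with the maximally entangled state. -/
theorem IsKExtendibleState.trace_maxEntangled_mul_re_le (hM : 1 ≤ M) {σ : Op (Fin M × Fin M)}
    (hσ : IsKExtendibleState k σ) :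
    (maxEntangled M * σ).trace.re ≤ 1 / (M : ℝ) + 1 / (k : ℝ) - 1 / ((M : ℝ) * (k : ℝ)) := by
  obtain ⟨-, τ, hτ, hp, rfl⟩ := hσ
  have h1 := sum_overlap_re_le hM hτ.1
  simp only [overlap_eq_zero_index hp, Finset.sum_const, Finset.card_univ, Fintype.card_fin, hτ.2,
    nsmul_eq_mul] at h1
  rw [trace_maxEntangled_mul, ← overlap_zero]
  have hM0 : (0 : ℝ) < M := by exact_mod_cast hM
  have hk0 : (0 : ℝ) < k := by exact_mod_cast Nat.pos_of_ne_zero (NeZero.ne k)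
  have h2 : ((1 / M : ℂ) * overlap τ 0).re = 1 / (M : ℝ) * (overlap τ 0).re := by
    rw [← Complex.re_ofReal_mul]; push_cast; rfl
  have h3 : (k : ℝ) * (overlap τ 0).re ≤ M + k - 1 := by
    rw [← Complex.re_ofReal_mul]; simpa using h1
  have h4 : (overlap τ 0).re ≤ (M + k - 1) / k := by rw [le_div_iff₀ hk0]; linarith
  rw [h2]
  calc 1 / (M : ℝ) * (overlap τ 0).re ≤ 1 / (M : ℝ) * ((M + k - 1) / k) := by gcongr
    _ = _ := by field_simp; ring

end ExtendibleState

/-! ### Fidelity with a pure state -/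

section Fidelity

variable {A : Type*} [Fintype A] [DecidableEq A]

/-- With `Φ = |φ⟩⟨φ|` and `t = ⟨φ, ρφ⟩`, one has `√Φ = Φ` and `(√ρ Φ)†(√ρ Φ) = ΦρΦ = tΦ`, so the
trace norm is `√t`. -/
theorem fidelity_vecMulVec {ρ : Op A} (hρ : ρ.PosSemidef) {φ : A → ℂ} (hφ : star φ ⬝ᵥ φ = 1) :
    fidelity ρ (Matrix.vecMulVec φ (star φ)) = (Matrix.vecMulVec φ (star φ) * ρ).trace.re := by
  set Φ : Op A := Matrix.vecMulVec φ (star φ) with hΦ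
  have hPSD : Φ.PosSemidef := Matrix.posSemidef_vecMulVec_self_star φ
  have hidem : Φ * Φ = Φ := by rw [hΦ, Matrix.vecMulVec_mul_vecMulVec, hφ, one_smul]
  have hsqrt : CFC.sqrt Φ = Φ := CFC.sqrt_unique hidem (Matrix.nonneg_iff_posSemidef.2 hPSD)
  have hρs : (CFC.sqrt ρ).conjTranspose = CFC.sqrt ρ :=
    (Matrix.nonneg_iff_posSemidef.1 (CFC.sqrt_nonneg ρ)).isHermitian
  set t : ℂ := star φ ⬝ᵥ (ρ.mulVec φ) with ht
  have ht0 : 0 ≤ t := hρ.dotProduct_mulVec_nonneg φ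
  have htr : (Φ * ρ).trace = t := by
    rw [hΦ, Matrix.vecMulVec_mul, Matrix.trace_vecMulVec, ht, Matrix.dotProduct_mulVec,
      dotProduct_comm]
  have hmul : (CFC.sqrt ρ * Φ).conjTranspose * (CFC.sqrt ρ * Φ) = t • Φ := by
    rw [Matrix.conjTranspose_mul, hρs, hPSD.isHermitian.eq, Matrix.mul_assoc,
      ← Matrix.mul_assoc (CFC.sqrt ρ),
      CFC.sqrt_mul_sqrt_self ρ (Matrix.nonneg_iff_posSemidef.2 hρ), hΦ, Matrix.mul_vecMulVec,
      Matrix.vecMulVec_mul_vecMulVec, ← ht, Matrix.vecMulVec_smul]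
  have hre : ((t.re : ℝ) : ℂ) = t := (Complex.eq_re_of_ofReal_le ht0).symm
  have htre : 0 ≤ t.re := (Complex.le_def.1 ht0).1
  have hs2 : CFC.sqrt (t • Φ) = ((Real.sqrt t.re : ℝ) : ℂ) • Φ := by
    refine CFC.sqrt_unique ?_ (Matrix.nonneg_iff_posSemidef.2 (hPSD.smul ?_))
    · rw [smul_mul_smul_comm, hidem, ← Complex.ofReal_mul, Real.mul_self_sqrt htre, hre]
    · exact_mod_cast Real.sqrt_nonneg _
  rw [fidelity, traceNorm, hsqrt, hmul, hs2, htr, Matrix.trace_smul, hΦ, Matrix.trace_vecMulVec,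
    dotProduct_comm, hφ, smul_eq_mul, mul_one, Complex.ofReal_re, Real.sq_sqrt htre]

theorem posSemidef_one_sub_vecMulVec {φ : A → ℂ} (hφ : star φ ⬝ᵥ φ = 1) :
    (1 - Matrix.vecMulVec φ (star φ) : Op A).PosSemidef := by
  set Φ : Op A := Matrix.vecMulVec φ (star φ) with hΦ
  have hidem : Φ * Φ = Φ := by rw [hΦ, Matrix.vecMulVec_mul_vecMulVec, hφ, one_smul]
  have hH : Φ.conjTranspose = Φ := (Matrix.posSemidef_vecMulVec_self_star φ).isHermitian
  have := Matrix.posSemidef_conjTranspose_mul_self (1 - Φ)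
  simpa [hH, sub_mul, mul_sub, hidem] using this

/-- The unit vector that spans the range of the maximally entangled state. -/
def maxEntangledVec (M : ℕ) (p : Fin M × Fin M) : ℂ :=
  if p.1 = p.2 then ((Real.sqrt M)⁻¹ : ℝ) else 0

theorem maxEntangled_eq_vecMulVec (M : ℕ) :
    maxEntangled M = Matrix.vecMulVec (maxEntangledVec M) (star (maxEntangledVec M)) := by
  have h : ((Real.sqrt M)⁻¹ : ℂ) * (Real.sqrt M : ℂ)⁻¹ = (M : ℂ)⁻¹ := by
    rw [← mul_inv, ← Complex.ofReal_mul, Real.mul_self_sqrt (Nat.cast_nonneg M)]; simp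
  ext p q
  by_cases hp : p.1 = p.2 <;> by_cases hq : q.1 = q.2 <;>
    simp [maxEntangled, Matrix.vecMulVec_apply, maxEntangledVec, hp, hq, h]

theorem star_maxEntangledVec_dotProduct {M : ℕ} (hM : 1 ≤ M) :
    star (maxEntangledVec M) ⬝ᵥ maxEntangledVec M = 1 := by
  have h : ((Real.sqrt M)⁻¹ : ℂ) * (Real.sqrt M : ℂ)⁻¹ = (M : ℂ)⁻¹ := by
    rw [← mul_inv, ← Complex.ofReal_mul, Real.mul_self_sqrt (Nat.cast_nonneg M)]; simp
  have hM0 : (M : ℂ) ≠ 0 := by exact_mod_cast (by omega : M ≠ 0)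
  simp [dotProduct, Fintype.sum_prod_type, maxEntangledVec, h, hM0]

theorem posSemidef_maxEntangled (M : ℕ) : (maxEntangled M).PosSemidef := by
  rw [maxEntangled_eq_vecMulVec]
  exact Matrix.posSemidef_vecMulVec_self_star _

theorem posSemidef_one_sub_maxEntangled {M : ℕ} (hM : 1 ≤ M) :
    (1 - maxEntangled M).PosSemidef := by
  rw [maxEntangled_eq_vecMulVec]
  exact posSemidef_one_sub_vecMulVec (star_maxEntangledVec_dotProduct hM)

theorem fidelity_maxEntangled {M : ℕ} (hM : 1 ≤ M) {ρ : Op (Fin M × Fin M)}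
    (hρ : ρ.PosSemidef) : fidelity ρ (maxEntangled M) = (maxEntangled M * ρ).trace.re := by
  rw [maxEntangled_eq_vecMulVec]
  exact fidelity_vecMulVec hρ (star_maxEntangledVec_dotProduct hM)

end Fidelity

/-! ### Pulling tests back along channels -/

section Adjoint

variable {A B : Type*} [Fintype A] [Fintype B]

theorem trace_mul_nonneg {X Y : Op A} (hX : X.PosSemidef) (hY : Y.PosSemidef) :
    0 ≤ (X * Y).trace := by
  obtain ⟨C, rfl⟩ := exists_eq_conjTranspose_mul_self hX
  rw [Matrix.mul_assoc, Matrix.trace_mul_comm]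
  exact (hY.mul_mul_conjTranspose_same C).trace_nonneg

/-- Rank-one `X` give a nonnegative quadratic form; over `ℂ`, a real quadratic form already forces
`Y` to be Hermitian. -/
theorem posSemidef_of_trace_mul_nonneg {Y : Op A}
    (h : ∀ X : Op A, X.PosSemidef → 0 ≤ (Y * X).trace) : Y.PosSemidef := by
  classical
  have h1 : ∀ x : A → ℂ, 0 ≤ star x ⬝ᵥ (Y.mulVec x) := fun x => by
    have := h _ (Matrix.posSemidef_vecMulVec_self_star x)
    rwa [Matrix.mul_vecMulVec, Matrix.trace_vecMulVec, dotProduct_comm] at this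
  refine Matrix.PosSemidef.of_dotProduct_mulVec_nonneg
    (Matrix.isSymmetric_toEuclideanLin_iff.1
      ((LinearMap.isSymmetric_iff_inner_map_self_real _).2 fun v => ?_)) h1
  have h2 : inner ℂ (Matrix.toEuclideanLin Y v) v = star (star v.ofLp ⬝ᵥ Y.mulVec v.ofLp) := by
    rw [← Matrix.star_dotProduct_star, star_star, dotProduct_comm]
    rfl
  rw [h2]
  exact congrArg star (Complex.conj_eq_iff_im.2 (Complex.le_def.1 (h1 _)).2.symm)

/-- The adjoint of a superoperator with respect to the Hilbert-Schmidt pairing `Tr[Y X]`. -/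
theorem exists_trace_mul_eq (Φ : Op A →ₗ[ℂ] Op B) (Y : Op B) :
    ∃ Z : Op A, ∀ X, (Z * X).trace = (Y * Φ X).trace := by
  classical
  refine ⟨Matrix.of fun i j => (Y * Φ (Matrix.single j i 1)).trace, fun X => ?_⟩
  have hX : (Y * Φ X).trace = ∑ j, ∑ i, X j i * (Y * Φ (Matrix.single j i 1)).trace := by
    conv_lhs => rw [Matrix.matrix_eq_sum_single X]
    simp only [map_sum, Matrix.mul_sum, Matrix.trace_sum]
    refine Finset.sum_congr rfl fun j _ => Finset.sum_congr rfl fun i _ => ?_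
    rw [show Matrix.single j i (X j i) = X j i • Matrix.single j i (1 : ℂ) by simp, map_smul,
      Matrix.mul_smul, Matrix.trace_smul, smul_eq_mul]
  rw [hX, Finset.sum_comm, Matrix.trace]
  exact Finset.sum_congr rfl fun i _ => Finset.sum_congr rfl fun j _ => mul_comm _ _

/-- Data processing for a test: the pull-back of a test along a channel. -/
theorem IsChannel.exists_test [DecidableEq A] [DecidableEq B] {Φ : Op A →ₗ[ℂ] Op B}
    (h : IsChannel Φ) {Y : Op B} (hY : Y.PosSemidef) (hY1 : (1 - Y).PosSemidef) :
    ∃ Λ : Op A, Λ.PosSemidef ∧ (1 - Λ).PosSemidef ∧ ∀ X, (Λ * X).trace = (Y * Φ X).trace := by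
  obtain ⟨Λ, hΛ⟩ := exists_trace_mul_eq Φ Y
  refine ⟨Λ, posSemidef_of_trace_mul_nonneg fun X hX => ?_,
    posSemidef_of_trace_mul_nonneg fun X hX => ?_, hΛ⟩
  · rw [hΛ]; exact trace_mul_nonneg hY (h.1.posSemidef_apply hX)
  -- Trace preservation turns `Tr[(1 - Y) Φ(X)]` into `Tr[(1 - Λ) X]`.
  · have := trace_mul_nonneg hY1 (h.1.posSemidef_apply hX)
    rwa [sub_mul, one_mul, Matrix.trace_sub, h.2, ← hΛ, ← Matrix.trace_sub,
      ← one_sub_mul] at this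

theorem hypTestInf_le [DecidableEq A] {ε : ℝ} {ρ σ Λ : Op A} (hσ : σ.PosSemidef)
    (hΛ : Λ.PosSemidef) (hΛ1 : (1 - Λ).PosSemidef) (h : 1 - ε ≤ (Λ * ρ).trace.re) :
    hypTestInf ε ρ σ ≤ (Λ * σ).trace.re := by
  -- A real `sInf` is below its members only if the set is bounded below; positivity of `σ` supplies
  -- the bound `0`.
  refine csInf_le ⟨0, ?_⟩ ⟨Λ, hΛ, hΛ1, h, rfl⟩
  rintro _ ⟨Λ', hΛ', -, -, rfl⟩
  exact (Complex.le_def.1 (trace_mul_nonneg hΛ' hσ)).1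

theorem le_negLog2 {x c : ℝ} (h : x ≤ c) : ((-Real.logb 2 c : ℝ) : EReal) ≤ negLog2 x := by
  rw [negLog2]
  split_ifs with hx
  · exact le_top
  · exact EReal.coe_le_coe_iff.2
      (neg_le_neg (Real.logb_le_logb_of_le one_lt_two (not_le.1 hx) h))

end Adjoint

end

end KExt

/-! ### The converse bound -/

theorem mainTheorem7 {A B R Bh : Type*}
    [Fintype A] [Fintype B] [Fintype R] [DecidableEq R] [Fintype Bh] [DecidableEq Bh]
    (k : ℕ) [NeZero k] (N : Op A →ₗ[ℂ] Op B) (ω : Op (R × Bh)) (hN : IsKSimulableWith k N ω)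
    (n M : ℕ) (hn : 1 ≤ n) (hM : 1 ≤ M) (ε : ℝ) (hε : ε ∈ Set.Icc (0 : ℝ) 1)
    (P : Protocol k N n M) (hP : P.Achieves ε) :
    ((-Real.logb 2 (1 / (M : ℝ) + 1 / (k : ℝ) - 1 / ((M : ℝ) * (k : ℝ))) : ℝ) : EReal) ≤
      unextHypTestDiv k ε (tensorPow ω n) := by
  obtain ⟨L, hL, hLω⟩ := P.exists_isKExtendibleChannel_output hN hn
  obtain ⟨Λ, hΛ, hΛ1, hΛL⟩ := hL.1.exists_test (posSemidef_maxEntangled M)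
    (posSemidef_one_sub_maxEntangled hM)
  have hout := hL.1.1.posSemidef_apply (posSemidef_tensorPow hN.2.1.1 n)
  -- The same pulled-back test `Λ` serves every `k`-extendible `σ`: the first goal is its
  -- feasibility on `ω^{⊗n}`, the second its value on `σ`.
  refine le_iInf₂ fun σ hσ => le_negLog2 ((hypTestInf_le hσ.1.1 hΛ hΛ1 ?_).trans ?_)
  · rw [hΛL, ← fidelity_maxEntangled hM hout, hLω]
    exact hP
  · rw [hΛL]
    exact (hL.isKExtendibleState_apply hσ).trace_maxEntangled_mul_re_le hM
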